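/- Let $\mathbb K$ be the completion of an algebraic closure of $\mathbb C((t^{-1}))$, with the non-archimedean absolute value extending $|\varphi|=e^{\deg\varphi}$ on $\mathbb C((t^{-1}))$. Let $\mathbb C\mathbb L_\infty$ be the $\mathbb C$-algebra of Laurent series at infinity in $X,Y$, i.e. of the formal sums $\sum_{e\le N}f_e$ ($N\in\mathbb Z$) with $f_e$ a homogeneous Laurent polynomial of degree $e$ over $\mathbb C$; such a series converges at every $(x,y)\in\mathbb K^2$ with $|x|=|y|>1$, and $\deg F<0$ means that $F$ contains only monomials of negative total degree. Let $n_1,n_2\ge 1$ be integers, $n_1\ne n_2$, $k=\gcd(n_1,n_2)$, and let $f,g\in\mathbb C\mathbb L_\infty$. Assume that $g=X^{n_1}Y^{n_2}(1+u)$ with $\deg u<0$, and put $$g^{1/k}=X^{n_1/k}Y^{n_2/k}\sum_{l\ge 0}\binom{1/k}{l}u^l .$$ Assume that there are a Laurent polynomial $W\in\mathbb C[T,T^{-1}]$ and $d\in\mathbb C\setminus\{0\}$ with $$f-W(g^{1/k})=d\,X^{1-n_1}Y^{1-n_2}(1+z),\qquad z\in\mathbb C\mathbb L_\infty,\ \deg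 z<0 .$$ Let $\varepsilon\in\mathbb C$ be a primitive $k$-th root of unity, let $1<\rho_0\le\rho$, let $(x_0,y_0)$ be a point of $V=\{(x,y)\in\mathbb K^2:\rho_0\le|x|=|y|\le\rho\}$, and put $r=|x_0|=|y_0|$, $T_{r,r}=\{(x,y)\in\mathbb K^2:|x|=|y|=r\}$, $\alpha_0=f(x_0,y_0)$, $\widetilde\beta_0=g^{1/k}(x_0,y_0)$. Then for every fixed $i\in\{0,\dots,k-1\}$ the system $$f(X,Y)=\alpha_0,\qquad \varepsilon^i g^{1/k}(X,Y)=\widetilde\beta_0$$ has exactly $|n_1-n_2|/k$ solutions in $T_{r,r}$ if and only if it has at least one solution in $T_{r,r}$. -/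

import Mathlib

open scoped LaurentSeries NNReal LaurentPolynomial

noncomputable section

/-! ### The field `𝕂`, the completion of an algebraic closure of `ℂ((t⁻¹))` -/

/-- The field `ℂ((t⁻¹))` of formal Laurent series in one variable at infinity.  It is the field of
formal Laurent series over `ℂ` in the variable `s = t⁻¹`; the coefficient of `t ^ i` is the
coefficient with index `-i`. -/
abbrev LaurentAtInfinity : Type := ℂ⸨X⸩

namespace LaurentAtInfinity

theorem one_lt_exp_one : (1 : ℝ≥0) < (Real.exp 1).toNNReal := by
  simp

/-- The `t⁻¹`-adic valuation has rank one; its value `exp (-n)` (in `ℤᵐ⁰`) is sent to the real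
number `e ^ (-n)`. -/
instance rankOne : Valuation.RankOne (Valued.v (R := LaurentAtInfinity)) where
  hom' := (WithZeroMulInt.toNNReal one_lt_exp_one.ne_zero).comp
    MonoidWithZeroHom.ValueGroup₀.embedding
  strictMono' := (WithZeroMulInt.toNNReal_strictMono one_lt_exp_one).comp
    MonoidWithZeroHom.ValueGroup₀.embedding_strictMono
  exists_val_nontrivial := by
    refine ⟨HahnSeries.single (1 : ℤ) (1 : ℂ), ?_⟩
    have h := LaurentSeries.valuation_single_zpow ℂ 1
    rw [h]
    exact ⟨WithZero.coe_ne_zero, by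
      rw [← WithZero.exp_zero]
      exact fun h => by simpa using WithZero.exp_injective h⟩

/-- The absolute value `|φ| = e ^ deg φ` on `ℂ((t⁻¹))`. -/
instance : NontriviallyNormedField LaurentAtInfinity :=
  Valued.toNontriviallyNormedField LaurentAtInfinity (WithZero (Multiplicative ℤ))

theorem norm_def (φ : LaurentAtInfinity) :
    ‖φ‖ = WithZeroMulInt.toNNReal one_lt_exp_one.ne_zero (Valued.v φ) := by
  have h : ‖φ‖ = Valued.v.norm φ := rfl
  rw [h, Valuation.norm_def]
  change ((WithZeroMulInt.toNNReal one_lt_exp_one.ne_zero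
    (MonoidWithZeroHom.ValueGroup₀.embedding (Valued.v.restrict φ)) : ℝ≥0) : ℝ) = _
  rw [Valuation.embedding_restrict]

/-- `|φ| = e ^ (-n)` if `n` is the order of `φ ≠ 0` in `t⁻¹`, that is, if `-n = deg φ`. -/
theorem norm_eq_exp (φ : LaurentAtInfinity) (hφ : φ ≠ 0) :
    ‖φ‖ = Real.exp (-(φ.order : ℝ)) := by
  have h : Valued.v φ = WithZero.exp (-φ.order) := by
    apply le_antisymm
    · exact (LaurentSeries.valuation_le_iff_coeff_lt_eq_zero ℂ).2
        fun n hn => HahnSeries.coeff_eq_zero_of_lt_order hn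
    · by_contra hlt
      have h0 : Valued.v φ ≤ WithZero.exp (-(φ.order + 1)) := by
        have hne : Valued.v φ ≠ 0 := (Valuation.ne_zero_iff _).2 hφ
        rw [not_le, ← WithZero.log_lt_iff_lt_exp hne] at hlt
        rw [← WithZero.log_le_iff_le_exp hne]
        omega
      exact HahnSeries.coeff_order_eq_zero.not.2 hφ
        ((LaurentSeries.valuation_le_iff_coeff_lt_eq_zero ℂ).1 h0 _ (by omega))
  rw [norm_def, h, WithZeroMulInt.toNNReal_neg_apply _ WithZero.exp_ne_zero]
  have h1 : (WithZero.unzero (WithZero.exp_ne_zero (a := -φ.order))).toAdd = -φ.order := rfl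
  rw [h1]
  push_cast
  rw [Real.coe_toNNReal _ (Real.exp_pos 1).le, ← Real.rpow_intCast, Real.exp_one_rpow]
  push_cast
  rfl

instance : IsUltrametricDist LaurentAtInfinity :=
  inferInstance

instance : CompleteSpace LaurentAtInfinity :=
  LaurentSeries.instLaurentSeriesComplete

end LaurentAtInfinity

/-- An algebraic closure of `ℂ((t⁻¹))` (formal Puiseux series at infinity). -/
abbrev PuiseuxAtInfinity : Type := AlgebraicClosure LaurentAtInfinity

namespace PuiseuxAtInfinity

/-- The unique extension of the absolute value of `ℂ((t⁻¹))`. -/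
instance : NontriviallyNormedField PuiseuxAtInfinity :=
  spectralNorm.nontriviallyNormedField LaurentAtInfinity PuiseuxAtInfinity

end PuiseuxAtInfinity

/-- The complete non-archimedean field `𝕂`: the completion of an algebraic closure of `ℂ((t⁻¹))`. -/
abbrev KInf : Type := UniformSpace.Completion PuiseuxAtInfinity

/-- The embedding of the complex numbers into `𝕂` as constants. -/
def constK : ℂ →+* KInf :=
  (algebraMap PuiseuxAtInfinity KInf).comp
    ((algebraMap LaurentAtInfinity PuiseuxAtInfinity).comp HahnSeries.C)

instance : IsUltrametricDist PuiseuxAtInfinity :=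
  IsUltrametricDist.isUltrametricDist_of_forall_norm_add_le_max_norm
    (isNonarchimedean_spectralNorm (K := LaurentAtInfinity) (L := PuiseuxAtInfinity))

instance : IsUltrametricDist KInf :=
  IsUltrametricDist.of_normedAlgebra PuiseuxAtInfinity

theorem norm_constK (c : ℂ) (hc : c ≠ 0) : ‖constK c‖ = 1 := by
  have h : (HahnSeries.C c : LaurentAtInfinity) ≠ 0 := by simpa using hc
  change ‖((algebraMap LaurentAtInfinity PuiseuxAtInfinity (HahnSeries.C c) :
    PuiseuxAtInfinity) : KInf)‖ = 1
  rw [UniformSpace.Completion.norm_coe]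
  change spectralNorm LaurentAtInfinity PuiseuxAtInfinity _ = 1
  rw [spectralNorm_extends, LaurentAtInfinity.norm_eq_exp _ h, HahnSeries.order_C]
  simp

/-! ### Laurent series at infinity in two variables -/

/-- The `ℂ`-algebra of formal Laurent series at infinity in two variables `X`, `Y`: the sums
`∑_{e ≤ N} f_e` in which `f_e` is a homogeneous Laurent polynomial of degree `e` over `ℂ`.
A homogeneous Laurent polynomial of degree `e` is `Y ^ e * p (X / Y)` for a unique Laurent
polynomial `p` in one variable `T`; so the series are the formal Laurent series in `Y⁻¹` whose
coefficients are Laurent polynomials in `T = X / Y`, and the component of degree `e` is the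
coefficient with index `-e`. -/
abbrev LInf : Type := HahnSeries ℤ ℂ[T;T⁻¹]

namespace LInf

/-- The coefficient of `X ^ i * Y ^ j`. -/
def mcoeff (F : LInf) (i j : ℤ) : ℂ := (F.coeff (-(i + j))).coeff i

/-- The monomial `X ^ i * Y ^ j`. -/
def mono (i j : ℤ) : LInf := HahnSeries.single (-(i + j)) (LaurentPolynomial.T i)

/-- The embedding of the complex numbers as constant series. -/
def const : ℂ →+* LInf := HahnSeries.C.comp LaurentPolynomial.C

theorem mcoeff_mono (i j a b : ℤ) : mcoeff (mono a b) i j = if i = a ∧ j = b then 1 else 0 := by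
  unfold mcoeff mono
  by_cases h : -(i + j) = -(a + b)
  · rw [h, HahnSeries.coeff_single_same, LaurentPolynomial.T, AddMonoidAlgebra.coeff_single,
      Finsupp.single_apply]
    congr 1
    apply propext
    constructor
    · intro h'; omega
    · intro h'; omega
  · rw [HahnSeries.coeff_single_of_ne h, if_neg (by omega)]
    rfl

theorem mono_mul (a b c d : ℤ) : mono a b * mono c d = mono (a + c) (b + d) := by
  simp only [mono, HahnSeries.single_mul_single, ← LaurentPolynomial.T_add]
  congr 1
  congr 1
  ring

theorem mono_zero : mono 0 0 = 1 := by
  simp [mono]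

@[ext]
theorem ext_mcoeff {F G : LInf} (h : ∀ i j, mcoeff F i j = mcoeff G i j) : F = G := by
  apply HahnSeries.ext
  funext e
  apply AddMonoidAlgebra.ext
  ext i
  have := h i (-e - i)
  simpa [mcoeff] using this

/-- The families of coefficients of the series at infinity are those that vanish in all large
degrees and that have finitely many nonzero members in every degree. -/
theorem exists_mcoeff_eq_iff (c : ℤ → ℤ → ℂ) :
    (∃ F : LInf, ∀ i j, mcoeff F i j = c i j) ↔
      (∃ N : ℤ, ∀ i j, N < i + j → c i j = 0) ∧ ∀ e : ℤ, {i | c i (e - i) ≠ 0}.Finite := by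
  constructor
  · rintro ⟨F, hF⟩
    refine ⟨⟨-F.order, fun i j h => ?_⟩, fun e => ?_⟩
    · rw [← hF, mcoeff, HahnSeries.coeff_eq_zero_of_lt_order (by omega)]
      rfl
    · refine ((F.coeff (-e)).coeff.support.finite_toSet).subset fun i hi => ?_
      have : c i (e - i) = (F.coeff (-e)).coeff i := by simp [← hF, mcoeff]
      simpa [this] using hi
  · rintro ⟨⟨N, hN⟩, hfin⟩
    let p : ℤ → ℂ[T;T⁻¹] := fun d => AddMonoidAlgebra.ofCoeff
      (Finsupp.ofSupportFinite (fun i => c i (-d - i)) (hfin (-d)))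
    have hp : ∀ d i, (p d).coeff i = c i (-d - i) := fun d i => rfl
    refine ⟨HahnSeries.ofSuppBddBelow p ⟨-N, ?_⟩, fun i j => ?_⟩
    · intro d hd
      by_contra hlt
      apply hd
      apply AddMonoidAlgebra.ext
      ext i
      rw [hp, hN _ _ (by omega)]
      rfl
    · have : (p (-(i + j))).coeff i = c i j := by rw [hp]; congr 1; ring
      exact this

/-- `deg F < 0`: all monomials of `F` have negative total degree. -/
def NegDeg (F : LInf) : Prop := ∀ i j : ℤ, 0 ≤ i + j → mcoeff F i j = 0

theorem NegDeg.orderTop_pos {F : LInf} (h : NegDeg F) : 0 < F.orderTop := by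
  have h0 : ∀ e : ℤ, e ≤ 0 → F.coeff e = 0 := fun e he => by
    apply AddMonoidAlgebra.ext
    ext i
    have := h i (-e - i) (by omega)
    simpa [mcoeff] using this
  by_contra hle
  rw [not_lt] at hle
  have hF : F ≠ 0 := by
    rintro rfl
    simp at hle
  rw [← HahnSeries.order_eq_orderTop_of_ne_zero hF] at hle
  exact HahnSeries.coeff_order_eq_zero.not.2 hF (h0 _ (by exact_mod_cast hle))

/-- The monomial `X ^ i * Y ^ j` as a unit. -/
def monoUnit (i j : ℤ) : LInfˣ where
  val := mono i j
  inv := mono (-i) (-j)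
  val_inv := by rw [mono_mul, add_neg_cancel, add_neg_cancel, mono_zero]
  inv_val := by rw [mono_mul, neg_add_cancel, neg_add_cancel, mono_zero]

/-- The binomial series `∑ l, (a choose l) * u ^ l`, the power `(1 + u) ^ a`, for `deg u < 0`. -/
def binomialPow (a : ℚ) (u : LInf) : LInfˣ where
  val := PowerSeries.heval u (PowerSeries.binomialSeries ℂ[T;T⁻¹] a)
  inv := PowerSeries.heval u (PowerSeries.binomialSeries ℂ[T;T⁻¹] (-a))
  val_inv := by
    rw [← map_mul, ← PowerSeries.binomialSeries_add, add_neg_cancel,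
      PowerSeries.binomialSeries_zero, map_one]
  inv_val := by
    rw [← map_mul, ← PowerSeries.binomialSeries_add, neg_add_cancel,
      PowerSeries.binomialSeries_zero, map_one]

/-- The `k`-th root `g ^ (1/k) = X ^ (n₁/k) * Y ^ (n₂/k) * ∑ l, (1/k choose l) * u ^ l` of a
series `g = X ^ n₁ * Y ^ n₂ * (1 + u)` with `deg u < 0`, for a common divisor `k` of `n₁`, `n₂`.
It is a unit of the algebra of series at infinity. -/
def kthRoot (n₁ n₂ k : ℕ) (g : LInf) : LInfˣ :=
  monoUnit (n₁ / k : ℕ) (n₂ / k : ℕ) *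
    binomialPow (1 / (k : ℚ)) (mono (-(n₁ : ℤ)) (-(n₂ : ℤ)) * g - 1)

theorem kthRoot_pow (n₁ n₂ k : ℕ) (hk : 0 < k) (h₁ : k ∣ n₁) (h₂ : k ∣ n₂) (g u : LInf)
    (hu : NegDeg u) (hg : g = mono n₁ n₂ * (1 + u)) :
    (kthRoot n₁ n₂ k g : LInf) ^ k = g := by
  have hm : ∀ (a b : ℤ) (l : ℕ), mono a b ^ l = mono (l * a) (l * b) := fun a b l => by
    induction l with
    | zero => simp [mono_zero]
    | succ l ih =>
      rw [pow_succ, ih, mono_mul]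
      congr 1 <;> push_cast <;> ring
  have hb : ∀ l : ℕ, PowerSeries.binomialSeries ℂ[T;T⁻¹] (1 / (k : ℚ)) ^ l =
      PowerSeries.binomialSeries ℂ[T;T⁻¹] ((l : ℚ) * (1 / (k : ℚ))) := fun l => by
    induction l with
    | zero => simp
    | succ l ih =>
      rw [pow_succ, ih, ← PowerSeries.binomialSeries_add]
      congr 1
      push_cast
      ring
  have hk0 : (k : ℚ) ≠ 0 := by exact_mod_cast hk.ne'
  have h1 : (k : ℚ) * (1 / (k : ℚ)) = ((1 : ℕ) : ℚ) := by
    field_simp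
    simp
  have hu' : mono (-(n₁ : ℤ)) (-(n₂ : ℤ)) * g - 1 = u := by
    rw [hg, ← mul_assoc, mono_mul, neg_add_cancel, neg_add_cancel, mono_zero]
    ring
  rw [kthRoot, hu', Units.val_mul, mul_pow]
  change mono _ _ ^ k * PowerSeries.heval u (PowerSeries.binomialSeries ℂ[T;T⁻¹] _) ^ k = g
  rw [← map_pow, hb, h1, PowerSeries.binomialSeries_nat, pow_one, map_add, map_one,
    PowerSeries.heval_X u hu.orderTop_pos, hm, hg]
  congr 2
  · exact_mod_cast Nat.mul_div_cancel' h₁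
  · exact_mod_cast Nat.mul_div_cancel' h₂

/-- `W (G)` for a Laurent polynomial `W` in one variable over `ℂ` and a unit `G`. -/
def substLaurent (W : ℂ[T;T⁻¹]) (G : LInfˣ) : LInf := LaurentPolynomial.eval₂ const G W

/-- The value at `(x, y) ∈ 𝕂²` of a series at infinity: the sum of the (unordered, convergent when
`1 < |x| = |y|`) family of the terms `c_{i,j} * x ^ i * y ^ j`. -/
def eval (F : LInf) (x y : KInf) : KInf :=
  ∑' p : ℤ × ℤ, constK (mcoeff F p.1 p.2) * x ^ p.1 * y ^ p.2

theorem summable_eval (F : LInf) (x y : KInf) (hx : 1 < ‖x‖) (hxy : ‖x‖ = ‖y‖) :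
    Summable fun p : ℤ × ℤ => constK (mcoeff F p.1 p.2) * x ^ p.1 * y ^ p.2 := by
  apply NonarchimedeanAddGroup.summable_of_tendsto_cofinite_zero
  rw [Metric.tendsto_nhds]
  intro δ hδ
  obtain ⟨M, hM⟩ := pow_unbounded_of_one_lt δ⁻¹ hx
  have hfin : ∀ e : ℤ, {p : ℤ × ℤ | p.1 + p.2 = e ∧ mcoeff F p.1 p.2 ≠ 0}.Finite := fun e => by
    refine ((F.coeff (-e)).coeff.support.finite_toSet.image fun i => (i, e - i)).subset ?_
    rintro ⟨i, j⟩ ⟨h, hc⟩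
    simp only at h hc
    refine ⟨i, ?_, by simp [← h]⟩
    rw [← h]
    simpa [mcoeff] using hc
  rw [Filter.eventually_cofinite]
  refine ((Set.finite_Icc (-(M : ℤ)) (-F.order)).biUnion fun e _ => hfin e).subset ?_
  rintro ⟨i, j⟩ hp
  simp only [Set.mem_ofPred_eq, dist_zero_right, not_lt] at hp
  have hc : mcoeff F i j ≠ 0 := by
    intro h0
    rw [h0] at hp
    simp at hp
    linarith
  simp only [Set.mem_iUnion, Set.mem_Icc]
  refine ⟨i + j, ⟨?_, ?_⟩, rfl, hc⟩
  · by_contra hlt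
    rw [norm_mul, norm_mul, norm_constK _ hc, norm_zpow, norm_zpow, ← hxy, one_mul,
      ← zpow_add₀ (by linarith)] at hp
    have h2 : ‖x‖ ^ (i + j) ≤ ‖x‖ ^ (-(M : ℤ)) := zpow_le_zpow_right₀ hx.le (by omega)
    rw [zpow_neg, zpow_natCast] at h2
    have h3 : (‖x‖ ^ M)⁻¹ < δ := inv_lt_of_inv_lt₀ hδ hM
    linarith
  · by_contra hlt
    apply hc
    rw [mcoeff, HahnSeries.coeff_eq_zero_of_lt_order (by omega)]
    rfl

end LInf

/-- The torus `T_{r,r} = {(x, y) : |x| = |y| = r}` in `𝕂²`. -/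
def torus (r : ℝ) : Set (KInf × KInf) := {p | ‖p.1‖ = r ∧ ‖p.2‖ = r}

/-- The set `V = {(x, y) : ρ₀ ≤ |x| = |y| ≤ ρ}` in `𝕂²`. -/
def annulusV (ρ₀ ρ : ℝ) : Set (KInf × KInf) := {p | ρ₀ ≤ ‖p.1‖ ∧ ‖p.1‖ = ‖p.2‖ ∧ ‖p.1‖ ≤ ρ}

end

/-!
Write `a = n₁ / k`, `b = n₂ / k` and `G = g ^ (1/k) = X ^ a Y ^ b (1 + w)` with `deg w < 0`. Two
points of the torus that agree on `G` agree on `W (G)`, so a nonempty solution set is the fibre of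
the pair `X ^ a Y ^ b (1 + w)`, `X ^ (1 - k a) Y ^ (1 - k b) (1 + z)` through one of its points
`(x₁, y₁)` (`LInf.encard_fibre`). In the coordinates `(x₁ s, y₁ t)` with `|s| = |t| = 1` the fibre
is the solution set of a monomial system perturbed by principal units, and elimination in the
monomials (`monomial_system_iff`) turns it into

  `s ^ (a - b) = U (s, t)`, `s t = V (s, t)`,

where `U` and `V` are within `c = |x₁|⁻¹ < 1` of `1` and `c`-Lipschitz (`PrincipalOn`, established
for series of negative degree in `LInf.NegDeg.principalOn`). With `N = |a - b|`, the unperturbed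
system has exactly the `N` solutions `(ζ, ζ⁻¹)`, `ζ ^ N = 1`. Since the residue characteristic is
zero, these are distinct modulo the maximal ideal, every solution of the perturbed system reduces to
one of them, and each of them lifts to exactly one solution, the fixed point of a contraction
(`existsUnique_mem_closedBall`, `encard_unitTorus_of_natPow`). Hence the fibre has
`N = |n₁ - n₂| / k` points.

That evaluation at a point with `1 < |x| = |y|` is multiplicative (`LInf.eval_mul`) is the Cauchy
product for unconditionally convergent series in a nonarchimedean field, applied to the expansion
into homogeneous components (`LInf.hasSum_eval`).
-/

/-! ### Systems of two equations on the unit torus of an ultrametric field -/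

section Ultrametric

variable {K : Type*} [NormedField K]

/-- A function on `S ⊆ K × K` whose values are within `c` of `1` and which is `c`-Lipschitz. For
`c < 1` these functions form a group under multiplication: the perturbations of the constant `1`
that do not affect the number of solutions of a nondegenerate system. -/
structure PrincipalOn (c : ℝ) (S : Set (K × K)) (h : K × K → K) : Prop where
  norm_sub_one_le : ∀ p ∈ S, ‖h p - 1‖ ≤ c
  norm_sub_le : ∀ p ∈ S, ∀ q ∈ S, ‖h p - h q‖ ≤ c * ‖p - q‖

namespace PrincipalOn

variable {c : ℝ} {S : Set (K × K)} {h h' : K × K → K}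

theorem const (hc₀ : 0 ≤ c) {x : K} (hx : ‖x - 1‖ ≤ c) : PrincipalOn c S fun _ => x where
  norm_sub_one_le _ _ := hx
  norm_sub_le p _ q _ := by
    rw [sub_self, norm_zero]
    positivity

/-- Precomposition with a map that does not increase distances. -/
theorem comp (H : PrincipalOn c S h) (hc₀ : 0 ≤ c) {S' : Set (K × K)} {φ : K × K → K × K}
    (hφ : ∀ p ∈ S', φ p ∈ S) (hφ' : ∀ p q, ‖φ p - φ q‖ ≤ ‖p - q‖) :
    PrincipalOn c S' fun p => h (φ p) where
  norm_sub_one_le p hp := H.norm_sub_one_le _ (hφ p hp)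
  norm_sub_le p hp q hq := (H.norm_sub_le _ (hφ p hp) _ (hφ q hq)).trans
    (mul_le_mul_of_nonneg_left (hφ' p q) hc₀)

end PrincipalOn

variable [IsUltrametricDist K]

theorem norm_sub_le_max (x y : K) : ‖x - y‖ ≤ max ‖x‖ ‖y‖ := by
  simpa [sub_eq_add_neg] using IsUltrametricDist.norm_add_le_max x (-y)

theorem norm_eq_one_of_norm_sub_one_lt {x : K} (hx : ‖x - 1‖ < 1) : ‖x‖ = 1 := by
  have h := IsUltrametricDist.norm_add_eq_max_of_norm_ne_norm (x := x - 1) (y := (1 : K))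
    (by rw [norm_one]; exact hx.ne)
  rw [sub_add_cancel, norm_one, max_eq_right hx.le] at h
  exact h

theorem norm_mul_sub_one_le {c : ℝ} (hc : c < 1) {x y : K} (hx : ‖x - 1‖ ≤ c)
    (hy : ‖y - 1‖ ≤ c) : ‖x * y - 1‖ ≤ c := by
  have h : x * y - 1 = x * (y - 1) + (x - 1) := by ring
  rw [h]
  refine (IsUltrametricDist.norm_add_le_max _ _).trans (max_le ?_ hx)
  rwa [norm_mul, norm_eq_one_of_norm_sub_one_lt (hx.trans_lt hc), one_mul]

theorem norm_pow_sub_one_le {c : ℝ} (hc₀ : 0 ≤ c) (hc : c < 1) {x : K} (hx : ‖x - 1‖ ≤ c)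
    (n : ℕ) : ‖x ^ n - 1‖ ≤ c := by
  induction n with
  | zero => simpa using hc₀
  | succ n ih =>
    rw [pow_succ]
    exact norm_mul_sub_one_le hc ih hx

/-- The difference quotient of `x ↦ x ^ N` on the ball of radius `c < 1` around `1` is congruent
to its derivative `N` at `1`. -/
theorem norm_geom_sum₂_sub_natCast_le {c : ℝ} (hc₀ : 0 ≤ c) (hc : c < 1) {x y : K}
    (hx : ‖x - 1‖ ≤ c) (hy : ‖y - 1‖ ≤ c) (N : ℕ) :
    ‖∑ i ∈ Finset.range N, x ^ i * y ^ (N - 1 - i) - N‖ ≤ c := by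
  have h : ∑ i ∈ Finset.range N, x ^ i * y ^ (N - 1 - i) - N =
      ∑ i ∈ Finset.range N, (x ^ i * y ^ (N - 1 - i) - 1) := by
    simp
  rw [h]
  exact IsUltrametricDist.norm_sum_le_of_forall_le_of_nonneg hc₀ fun i _ =>
    norm_mul_sub_one_le hc (norm_pow_sub_one_le hc₀ hc hx _) (norm_pow_sub_one_le hc₀ hc hy _)

/-- Raising to a power prime to the residue characteristic is isometric on principal units. -/
theorem norm_pow_sub_pow_eq {N : ℕ} (hN : ‖(N : K)‖ = 1) {x y : K} (hx : ‖x - 1‖ < 1)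
    (hy : ‖y - 1‖ < 1) : ‖x ^ N - y ^ N‖ = ‖x - y‖ := by
  have hc : max ‖x - 1‖ ‖y - 1‖ < 1 := max_lt hx hy
  have h := norm_geom_sum₂_sub_natCast_le (le_max_of_le_left (norm_nonneg _)) hc
    (le_max_left _ _) (le_max_right _ _) N
  have hS := IsUltrametricDist.norm_add_eq_max_of_norm_ne_norm
    (x := ∑ i ∈ Finset.range N, x ^ i * y ^ (N - 1 - i) - N) (y := (N : K))
    (by rw [hN]; exact (h.trans_lt hc).ne)
  rw [sub_add_cancel, hN, max_eq_right (h.trans hc.le)] at hS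
  rw [← geom_sum₂_mul, norm_mul, hS, one_mul]

namespace PrincipalOn

variable {c : ℝ} {S : Set (K × K)} {h h' : K × K → K}

theorem norm_eq_one (H : PrincipalOn c S h) (hc : c < 1) {p : K × K} (hp : p ∈ S) : ‖h p‖ = 1 :=
  norm_eq_one_of_norm_sub_one_lt ((H.norm_sub_one_le p hp).trans_lt hc)

theorem ne_zero (H : PrincipalOn c S h) (hc : c < 1) {p : K × K} (hp : p ∈ S) : h p ≠ 0 :=
  norm_ne_zero_iff.1 (by rw [H.norm_eq_one hc hp]; exact one_ne_zero)

theorem mul (H : PrincipalOn c S h) (H' : PrincipalOn c S h') (hc : c < 1) :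
    PrincipalOn c S fun p => h p * h' p where
  norm_sub_one_le p hp := norm_mul_sub_one_le hc (H.norm_sub_one_le p hp) (H'.norm_sub_one_le p hp)
  norm_sub_le p hp q hq := by
    have e : h p * h' p - h q * h' q = h p * (h' p - h' q) + (h p - h q) * h' q := by ring
    rw [e]
    refine (IsUltrametricDist.norm_add_le_max _ _).trans (max_le ?_ ?_)
    · rw [norm_mul, H.norm_eq_one hc hp, one_mul]
      exact H'.norm_sub_le p hp q hq
    · rw [norm_mul, H'.norm_eq_one hc hq, mul_one]
      exact H.norm_sub_le p hp q hq

theorem inv (H : PrincipalOn c S h) (hc : c < 1) : PrincipalOn c S fun p => (h p)⁻¹ where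
  norm_sub_one_le p hp := by
    have e : (h p)⁻¹ - 1 = (h p)⁻¹ * (1 - h p) := by
      rw [mul_sub, inv_mul_cancel₀ (H.ne_zero hc hp), mul_one]
    rw [e, norm_mul, norm_inv, H.norm_eq_one hc hp, inv_one, one_mul, norm_sub_rev]
    exact H.norm_sub_one_le p hp
  norm_sub_le p hp q hq := by
    rw [inv_sub_inv (H.ne_zero hc hp) (H.ne_zero hc hq), norm_div, norm_mul,
      H.norm_eq_one hc hp, H.norm_eq_one hc hq, mul_one, div_one, norm_sub_rev]
    exact H.norm_sub_le p hp q hq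

theorem pow (H : PrincipalOn c S h) (hc₀ : 0 ≤ c) (hc : c < 1) (n : ℕ) :
    PrincipalOn c S fun p => h p ^ n := by
  induction n with
  | zero => simpa using const hc₀ (x := (1 : K)) (by simpa using hc₀)
  | succ n ih => simpa only [pow_succ] using ih.mul H hc

end PrincipalOn

/-- One step of the simplified Newton iteration for `s ^ N = U (s, t)` at `s = 1`. -/
theorem PrincipalOn.newtonStep {c : ℝ} (hc₀ : 0 ≤ c) (hc : c < 1) {N : ℕ} (hN : ‖(N : K)‖ = 1)
    {U : K × K → K} (hU : PrincipalOn c (Metric.closedBall (1, 1) c) U) :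
    PrincipalOn c (Metric.closedBall (1, 1) c) fun p => p.1 - (p.1 ^ N - U p) / N := by
  have hN0 : (N : K) ≠ 0 := norm_ne_zero_iff.1 (by rw [hN]; exact one_ne_zero)
  have key : ∀ x y : K, ‖x - 1‖ ≤ c → ‖y - 1‖ ≤ c →
      ‖(x - x ^ N / N) - (y - y ^ N / N)‖ ≤ c * ‖x - y‖ := by
    intro x y hx hy
    have e : (x - x ^ N / N) - (y - y ^ N / N) =
        -((∑ i ∈ Finset.range N, x ^ i * y ^ (N - 1 - i) - N) * (x - y)) / N := by
      rw [sub_mul, geom_sum₂_mul]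
      field_simp
      ring
    rw [e, norm_div, norm_neg, norm_mul, hN, div_one]
    exact mul_le_mul_of_nonneg_right (norm_geom_sum₂_sub_natCast_le hc₀ hc hx hy N)
      (norm_nonneg _)
  have hball : ∀ p ∈ Metric.closedBall ((1, 1) : K × K) c, ‖p.1 - 1‖ ≤ c := fun p hp =>
    (norm_fst_le (p - (1, 1))).trans (mem_closedBall_iff_norm.1 hp)
  constructor
  · intro p hp
    have e : p.1 - (p.1 ^ N - U p) / N - 1 =
        ((p.1 - p.1 ^ N / N) - (1 - 1 ^ N / N)) + (U p - 1) / N := by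
      rw [one_pow]
      ring
    rw [e]
    refine (IsUltrametricDist.norm_add_le_max _ _).trans (max_le ?_ ?_)
    · refine (key _ _ (hball p hp) (by simpa using hc₀)).trans ?_
      exact (mul_le_of_le_one_right hc₀ ((hball p hp).trans hc.le))
    · rw [norm_div, hN, div_one]
      exact hU.norm_sub_one_le p hp
  · intro p hp q hq
    have e : (p.1 - (p.1 ^ N - U p) / N) - (q.1 - (q.1 ^ N - U q) / N) =
        ((p.1 - p.1 ^ N / N) - (q.1 - q.1 ^ N / N)) + (U p - U q) / N := by
      ring
    rw [e]
    refine (IsUltrametricDist.norm_add_le_max _ _).trans (max_le ?_ ?_)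
    · exact (key _ _ (hball p hp) (hball q hq)).trans
        (mul_le_mul_of_nonneg_left (norm_fst_le (p - q)) hc₀)
    · rw [norm_div, hN, div_one]
      exact hU.norm_sub_le p hp q hq

/-- The system `s ^ N = U (s, t)`, `s t = V (s, t)` has a unique solution near `(1, 1)`: its
solutions are the fixed points of the contraction `(s, t) ↦ (σ, V (s, t) / σ)`, where `σ` is the
Newton step for the first equation. -/
theorem existsUnique_mem_closedBall [CompleteSpace K] {c : ℝ} (hc₀ : 0 ≤ c) (hc : c < 1) {N : ℕ}
    (hN : ‖(N : K)‖ = 1) {U V : K × K → K} (hU : PrincipalOn c (Metric.closedBall (1, 1) c) U)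
    (hV : PrincipalOn c (Metric.closedBall (1, 1) c) V) :
    ∃! p : K × K, p ∈ Metric.closedBall (1, 1) c ∧ p.1 ^ N = U p ∧ p.1 * p.2 = V p := by
  have hN0 : (N : K) ≠ 0 := norm_ne_zero_iff.1 (by rw [hN]; exact one_ne_zero)
  have h₁ := hU.newtonStep hc₀ hc hN
  have h₂ := hV.mul (h₁.inv hc) hc
  set s : K × K → K := fun p => p.1 - (p.1 ^ N - U p) / N
  set F : K × K → K × K := fun p => (s p, V p * (s p)⁻¹)
  set B := Metric.closedBall ((1, 1) : K × K) c
  have hmaps : Set.MapsTo F B B := fun p hp =>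
    mem_closedBall_iff_norm.2 (max_le (h₁.norm_sub_one_le p hp) (h₂.norm_sub_one_le p hp))
  have hlip : ∀ p ∈ B, ∀ q ∈ B, ‖F p - F q‖ ≤ c * ‖p - q‖ := fun p hp q hq =>
    max_le (h₁.norm_sub_le p hp q hq) (h₂.norm_sub_le p hp q hq)
  have hfix : ∀ p ∈ B, F p = p ↔ p.1 ^ N = U p ∧ p.1 * p.2 = V p := by
    intro p hp
    have h0 := h₁.ne_zero hc hp
    rw [Prod.ext_iff]
    have e : (F p).1 = p.1 ↔ p.1 ^ N = U p := by
      change p.1 - (p.1 ^ N - U p) / N = p.1 ↔ _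
      rw [sub_eq_self, div_eq_zero_iff, or_iff_left hN0, sub_eq_zero]
    rw [e]
    refine and_congr_right fun h => ?_
    have hs1 : s p = p.1 := e.2 h
    change V p * (s p)⁻¹ = p.2 ↔ _
    rw [← div_eq_mul_inv, div_eq_iff h0, hs1, mul_comm p.2, eq_comm]
  have hcontr : ContractingWith ⟨c, hc₀⟩ (hmaps.restrict F B B) := by
    refine ⟨by exact_mod_cast hc, LipschitzWith.of_dist_le_mul fun p q => ?_⟩
    change dist (F p) (F q) ≤ c * dist (p : K × K) q
    rw [dist_eq_norm, dist_eq_norm]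
    exact hlip p p.2 q q.2
  obtain ⟨p, hp, hfp, -⟩ := hcontr.exists_fixedPoint' Metric.isClosed_closedBall.isComplete hmaps
    (Metric.mem_closedBall_self hc₀) (edist_ne_top _ _)
  refine ⟨p, ⟨hp, (hfix p hp).1 hfp⟩, fun q ⟨hq, hq'⟩ => ?_⟩
  have hfq : F q = q := (hfix q hq).2 hq'
  have h := hlip q hq p hp
  rw [hfq, hfp.eq] at h
  by_contra hne
  have h0 : 0 < ‖q - p‖ := norm_sub_pos_iff.2 hne
  nlinarith

/-- The set of pairs of elements of norm one. -/
def unitTorus (K : Type*) [NormedField K] : Set (K × K) := {p | ‖p.1‖ = 1 ∧ ‖p.2‖ = 1}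

/-- The unperturbed system `s ^ N = 1`, `s t = 1` has the `N` solutions `(ζ, ζ⁻¹)`, which are
pairwise incongruent modulo the maximal ideal; every solution of the perturbed system is congruent
to exactly one of them, and near each of them there is exactly one. -/
theorem encard_unitTorus_of_natPow [CompleteSpace K] {c : ℝ} (hc₀ : 0 ≤ c) (hc : c < 1) {N : ℕ}
    (hN : ‖(N : K)‖ = 1) {ζ₀ : K} (hζ₀ : IsPrimitiveRoot ζ₀ N) {U V : K × K → K}
    (hU : PrincipalOn c (unitTorus K) U) (hV : PrincipalOn c (unitTorus K) V) :
    {p ∈ unitTorus K | p.1 ^ N = U p ∧ p.1 * p.2 = V p}.encard = N := by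
  have hN0 : 0 < N := Nat.pos_of_ne_zero (by rintro rfl; simp at hN)
  have hroot : ∀ ζ ∈ Polynomial.nthRootsFinset N (1 : K), ζ ^ N = 1 ∧ ‖ζ‖ = 1 ∧ ζ ≠ 0 := by
    intro ζ hζ
    have h := (Polynomial.mem_nthRootsFinset hN0 1).1 hζ
    have h1 : ‖ζ‖ = 1 := by
      have := congrArg norm h
      rw [norm_pow, norm_one] at this
      exact (pow_eq_one_iff_of_nonneg (norm_nonneg _) hN0.ne').1 this
    exact ⟨h, h1, norm_ne_zero_iff.1 (by rw [h1]; exact one_ne_zero)⟩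
  have hball : ∀ p ∈ Metric.closedBall ((1, 1) : K × K) c, ‖p.1 - 1‖ ≤ c ∧ ‖p.2 - 1‖ ≤ c :=
    fun p hp => max_le_iff.1 (mem_closedBall_iff_norm.1 hp)
  have hex : ∀ ζ ∈ Polynomial.nthRootsFinset N (1 : K), ∃! q : K × K,
      q ∈ Metric.closedBall (1, 1) c ∧ q.1 ^ N = U (ζ * q.1, ζ⁻¹ * q.2) ∧
        q.1 * q.2 = V (ζ * q.1, ζ⁻¹ * q.2) := by
    intro ζ hζ
    obtain ⟨-, h1, -⟩ := hroot ζ hζ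
    have hφ : ∀ q ∈ Metric.closedBall ((1, 1) : K × K) c, (ζ * q.1, ζ⁻¹ * q.2) ∈ unitTorus K := by
      intro q hq
      constructor
      · rw [norm_mul, h1, one_mul, norm_eq_one_of_norm_sub_one_lt ((hball q hq).1.trans_lt hc)]
      · rw [norm_mul, norm_inv, h1, inv_one, one_mul,
          norm_eq_one_of_norm_sub_one_lt ((hball q hq).2.trans_lt hc)]
    have hφ' : ∀ p q : K × K,
        ‖((ζ * p.1, ζ⁻¹ * p.2) : K × K) - (ζ * q.1, ζ⁻¹ * q.2)‖ ≤ ‖p - q‖ := by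
      intro p q
      refine max_le ?_ ?_
      · change ‖ζ * p.1 - ζ * q.1‖ ≤ _
        rw [← mul_sub, norm_mul, h1, one_mul]
        exact norm_fst_le (p - q)
      · change ‖ζ⁻¹ * p.2 - ζ⁻¹ * q.2‖ ≤ _
        rw [← mul_sub, norm_mul, norm_inv, h1, inv_one, one_mul]
        exact norm_snd_le (p - q)
    exact existsUnique_mem_closedBall hc₀ hc hN (hU.comp hc₀ hφ hφ') (hV.comp hc₀ hφ hφ')
  choose! q hq hquniq using hex
  have himage : {p ∈ unitTorus K | p.1 ^ N = U p ∧ p.1 * p.2 = V p} =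
      (fun ζ => (ζ * (q ζ).1, ζ⁻¹ * (q ζ).2)) '' (Polynomial.nthRootsFinset N (1 : K) : Set K) := by
    ext p
    constructor
    · rintro ⟨hp, hpU, hpV⟩
      -- `∏ (s - ζ) = s ^ N - 1` has norm less than one, hence so has one of the factors.
      have hprod : ∏ ζ ∈ Polynomial.nthRootsFinset N (1 : K), ‖p.1 - ζ‖ < 1 := by
        have h := congrArg (Polynomial.eval p.1) (Polynomial.X_pow_sub_one_eq_prod hN0 hζ₀)
        simp only [Polynomial.eval_sub, Polynomial.eval_pow, Polynomial.eval_X,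
          Polynomial.eval_one, Polynomial.eval_prod, Polynomial.eval_C] at h
        rw [← norm_prod, ← h, hpU]
        exact (hU.norm_sub_one_le p hp).trans_lt hc
      obtain ⟨ζ, hζ, hlt⟩ : ∃ ζ ∈ Polynomial.nthRootsFinset N (1 : K), ‖p.1 - ζ‖ < 1 := by
        by_contra! hge
        exact hprod.not_ge (by simpa using Finset.prod_le_prod (fun _ _ => zero_le_one) hge)
      obtain ⟨hζN, hζ1, hζ0⟩ := hroot ζ hζ
      refine ⟨ζ, hζ, ?_⟩
      -- A distance less than one improves to `c`, because `x ↦ x ^ N` is isometric near `1`.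
      have hs : ‖ζ⁻¹ * p.1 - 1‖ ≤ c := by
        have h1 : ‖ζ⁻¹ * p.1 - 1‖ < 1 := by
          have e : ζ⁻¹ * p.1 - 1 = ζ⁻¹ * (p.1 - ζ) := by
            rw [mul_sub, inv_mul_cancel₀ hζ0]
          rwa [e, norm_mul, norm_inv, hζ1, inv_one, one_mul]
        have h2 := norm_pow_sub_pow_eq hN h1 (y := (1 : K)) (by simp)
        rw [one_pow, mul_pow, inv_pow, hζN, inv_one, one_mul, hpU] at h2
        rw [← h2]
        exact hU.norm_sub_one_le p hp
      have hs1 : ‖ζ⁻¹ * p.1‖ = 1 := norm_eq_one_of_norm_sub_one_lt (hs.trans_lt hc)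
      have ht : ‖ζ * p.2 - 1‖ ≤ c := by
        have e : ζ⁻¹ * p.1 * (ζ * p.2 - 1) = (V p - 1) - (ζ⁻¹ * p.1 - 1) := by
          rw [← hpV]
          field_simp
          ring
        have h := congrArg norm e
        rw [norm_mul, hs1, one_mul] at h
        rw [h]
        exact (norm_sub_le_max _ _).trans
          (max_le (hV.norm_sub_one_le p hp) hs)
      have e : (ζ⁻¹ * p.1, ζ * p.2) = q ζ := by
        refine hquniq ζ hζ _ ⟨mem_closedBall_iff_norm.2 (max_le hs ht), ?_⟩
        have e1 : ((ζ * (ζ⁻¹ * p.1), ζ⁻¹ * (ζ * p.2)) : K × K) = p := by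
          rw [mul_inv_cancel_left₀ hζ0, inv_mul_cancel_left₀ hζ0]
        simp only [e1]
        refine ⟨?_, ?_⟩
        · rw [mul_pow, inv_pow, hζN, inv_one, one_mul, hpU]
        · rw [← hpV]
          field_simp
      change (ζ * (q ζ).1, ζ⁻¹ * (q ζ).2) = p
      rw [← e, mul_inv_cancel_left₀ hζ0, inv_mul_cancel_left₀ hζ0]
    · rintro ⟨ζ, hζ, rfl⟩
      obtain ⟨hζN, hζ1, hζ0⟩ := hroot ζ hζ
      obtain ⟨hqB, hqU, hqV⟩ := hq ζ hζ
      refine ⟨⟨?_, ?_⟩, ?_, ?_⟩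
      · rw [norm_mul, hζ1, one_mul,
          norm_eq_one_of_norm_sub_one_lt ((hball _ hqB).1.trans_lt hc)]
      · rw [norm_mul, norm_inv, hζ1, inv_one, one_mul,
          norm_eq_one_of_norm_sub_one_lt ((hball _ hqB).2.trans_lt hc)]
      · rw [mul_pow, hζN, one_mul, hqU]
      · rw [← hqV]
        field_simp
  have hinj : Set.InjOn (fun ζ => (ζ * (q ζ).1, ζ⁻¹ * (q ζ).2))
      (Polynomial.nthRootsFinset N (1 : K) : Set K) := by
    intro ζ hζ ξ hξ hζξ
    obtain ⟨hζN, hζ1, hζ0⟩ := hroot ζ hζ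
    obtain ⟨hξN, hξ1, hξ0⟩ := hroot ξ hξ
    have h1 : ζ * (q ζ).1 = ξ * (q ξ).1 := (Prod.ext_iff.1 hζξ).1
    have hsζ := (hball _ (hq ζ hζ).1).1
    have hsξ := (hball _ (hq ξ hξ).1).1
    -- Roots of unity with a common nearby solution are congruent, hence equal.
    have hlt : ‖ξ⁻¹ * ζ - 1‖ < 1 := by
      have e : (ξ⁻¹ * ζ - 1) * (q ζ).1 = ((q ξ).1 - 1) - ((q ζ).1 - 1) := by
        have : ξ⁻¹ * ζ * (q ζ).1 = (q ξ).1 := by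
          rw [mul_assoc, h1, inv_mul_cancel_left₀ hξ0]
        rw [sub_mul, this]
        ring
      have h := congrArg norm e
      rw [norm_mul, norm_eq_one_of_norm_sub_one_lt (hsζ.trans_lt hc), mul_one] at h
      rw [h]
      exact ((norm_sub_le_max _ _).trans (max_le hsξ hsζ)).trans_lt hc
    have h2 := norm_pow_sub_pow_eq hN hlt (y := (1 : K)) (by simp)
    rw [one_pow, mul_pow, inv_pow, hζN, hξN, inv_one, one_mul, sub_self, norm_zero, eq_comm,
      norm_eq_zero, sub_eq_zero, inv_mul_eq_one₀ hξ0] at h2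
    exact h2.symm
  rw [himage, hinj.encard_image, Set.encard_coe_eq_coe_finsetCard, hζ₀.card_nthRootsFinset]

/-- The version of `encard_unitTorus_of_natPow` with an integer exponent of either sign. -/
theorem encard_unitTorus_of_zpow [CompleteSpace K] {c : ℝ} (hc₀ : 0 ≤ c) (hc : c < 1) {D : ℤ}
    (hN : ‖(D.natAbs : K)‖ = 1) {ζ₀ : K} (hζ₀ : IsPrimitiveRoot ζ₀ D.natAbs) {U V : K × K → K}
    (hU : PrincipalOn c (unitTorus K) U) (hV : PrincipalOn c (unitTorus K) V) :
    {p ∈ unitTorus K | p.1 ^ D = U p ∧ p.1 * p.2 = V p}.encard = D.natAbs := by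
  rcases D.natAbs_eq with h | h
  · rw [← encard_unitTorus_of_natPow hc₀ hc hN hζ₀ hU hV]
    congr 1
    ext p
    rw [h]
    simp only [zpow_natCast, Int.natAbs_natCast]
  · rw [← encard_unitTorus_of_natPow hc₀ hc hN hζ₀ (hU.inv hc) hV]
    congr 1
    ext p
    rw [h]
    simp only [zpow_neg, zpow_natCast, Int.natAbs_neg, Int.natAbs_natCast, inv_eq_iff_eq_inv]

end Ultrametric

/-! ### Evaluation of series at infinity -/

theorem norm_zpow_sub_zpow_le {K : Type*} [NormedField K] [IsUltrametricDist K] {x y : K}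
    (hx : ‖x‖ = 1) (hy : ‖y‖ = 1) (i : ℤ) : ‖x ^ i - y ^ i‖ ≤ ‖x - y‖ := by
  have hnat : ∀ n : ℕ, ‖x ^ n - y ^ n‖ ≤ ‖x - y‖ := by
    intro n
    rw [← geom_sum₂_mul, norm_mul]
    refine mul_le_of_le_one_left (norm_nonneg _) ?_
    refine IsUltrametricDist.norm_sum_le_of_forall_le_of_nonneg zero_le_one fun i _ => ?_
    simp [hx, hy]
  obtain ⟨n, rfl | rfl⟩ := i.eq_nat_or_neg
  · simpa only [zpow_natCast] using hnat n
  · have hx0 : x ^ n ≠ 0 := pow_ne_zero _ (norm_ne_zero_iff.1 (by rw [hx]; exact one_ne_zero))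
    have hy0 : y ^ n ≠ 0 := pow_ne_zero _ (norm_ne_zero_iff.1 (by rw [hy]; exact one_ne_zero))
    rw [zpow_neg, zpow_neg, zpow_natCast, zpow_natCast, inv_sub_inv hx0 hy0, norm_div, norm_mul,
      norm_pow, norm_pow, hx, hy, one_pow, mul_one, div_one, norm_sub_rev]
    exact hnat n

instance : NonarchimedeanRing KInf :=
  ⟨fun U hU => NonarchimedeanAddGroup.is_nonarchimedean U hU⟩

theorem norm_constK_le (c : ℂ) : ‖constK c‖ ≤ 1 := by
  by_cases h : c = 0
  · simp [h]
  · exact (norm_constK c h).le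

namespace LInf

theorem mcoeff_add (F G : LInf) (i j : ℤ) : mcoeff (F + G) i j = mcoeff F i j + mcoeff G i j := rfl

/-- The value of a homogeneous component: substituting `x / y` in the Laurent polynomial `p` and
multiplying by `y ^ (-m)` evaluates the component of degree `-m` encoded by `p`. -/
theorem hasSum_homogeneous {x y : KInf} (hx : x ≠ 0) (hy : y ≠ 0) (p : ℂ[T;T⁻¹]) (m : ℤ) :
    HasSum (fun i : ℤ => constK (p.coeff i) * x ^ i * y ^ (-m - i))
      (LaurentPolynomial.eval₂ constK (Units.mk0 (x / y) (div_ne_zero hx hy)) p * y ^ (-m)) := by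
  induction p using LaurentPolynomial.induction_on' with
  | add p q hp hq =>
    rw [map_add, add_mul]
    refine (hp.add hq).congr_fun fun i => ?_
    rw [AddMonoidAlgebra.coeff_add, Finsupp.add_apply, map_add]
    ring
  | C_mul_T n a =>
    rw [LaurentPolynomial.eval₂_C_mul_T]
    have h : constK a * ((Units.mk0 (x / y) (div_ne_zero hx hy) ^ n : KInfˣ) : KInf) * y ^ (-m) =
        constK ((LaurentPolynomial.C a * LaurentPolynomial.T n).coeff n) * x ^ n *
          y ^ (-m - n) := by
      rw [← LaurentPolynomial.single_eq_C_mul_T, AddMonoidAlgebra.coeff_single,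
        Finsupp.single_eq_same, Units.val_zpow_eq_zpow_val, Units.val_mk0, div_zpow,
        zpow_sub₀ hy]
      ring
    rw [h]
    refine hasSum_single n fun i hi => ?_
    rw [← LaurentPolynomial.single_eq_C_mul_T, AddMonoidAlgebra.coeff_single,
      Finsupp.single_apply, if_neg hi.symm]
    simp

/-- The value of a series at infinity is the sum of the values of its homogeneous components. -/
theorem hasSum_eval (F : LInf) {x y : KInf} (hx : 1 < ‖x‖) (hxy : ‖x‖ = ‖y‖) (hx0 : x ≠ 0)
    (hy0 : y ≠ 0) :
    HasSum (fun m : ℤ =>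
      LaurentPolynomial.eval₂ constK (Units.mk0 (x / y) (div_ne_zero hx0 hy0)) (F.coeff m) *
        y ^ (-m)) (eval F x y) := by
  let e : ℤ × ℤ ≃ ℤ × ℤ :=
    { toFun := fun p => (p.2, -p.1 - p.2)
      invFun := fun p => (-(p.1 + p.2), p.1)
      left_inv := fun p => by ext <;> simp
      right_inv := fun p => by ext <;> simp }
  have h := (e.hasSum_iff (a := eval F x y)).2 (summable_eval F x y hx hxy).hasSum
  refine h.prod_fiberwise fun m => ?_
  convert! hasSum_homogeneous hx0 hy0 (F.coeff m) m using 2 with i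
  simp [e, mcoeff]

theorem eval_add (F G : LInf) {x y : KInf} (hx : 1 < ‖x‖) (hxy : ‖x‖ = ‖y‖) :
    eval (F + G) x y = eval F x y + eval G x y := by
  rw [eval, eval, eval, ← (summable_eval F x y hx hxy).tsum_add (summable_eval G x y hx hxy)]
  refine tsum_congr fun p => ?_
  rw [mcoeff_add, map_add]
  ring

theorem eval_mono (i j : ℤ) (x y : KInf) : eval (mono i j) x y = x ^ i * y ^ j := by
  rw [eval, tsum_eq_single (i, j)]
  · simp [mcoeff_mono]
  · rintro ⟨a, b⟩ hab
    rw [mcoeff_mono, if_neg (by simpa using hab)]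
    simp

theorem eval_const (c : ℂ) (x y : KInf) : eval (const c) x y = constK c := by
  have h : ∀ i j, mcoeff (const c) i j = if i = 0 ∧ j = 0 then c else 0 := by
    intro i j
    change ((HahnSeries.C (LaurentPolynomial.C c) : LInf).coeff (-(i + j))).coeff i = _
    rw [HahnSeries.C_apply, HahnSeries.coeff_single]
    by_cases hij : i + j = 0
    · rw [if_pos (by omega), LaurentPolynomial.C_apply]
      split_ifs <;> first | rfl | omega
    · rw [if_neg (by omega), if_neg (by omega)]
      rfl
  rw [eval, tsum_eq_single (0, 0)]
  · simp [h]
  · rintro ⟨a, b⟩ hab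
    rw [h, if_neg (by simpa using hab)]
    simp

theorem eval_mul (F G : LInf) {x y : KInf} (hx : 1 < ‖x‖) (hxy : ‖x‖ = ‖y‖) :
    eval (F * G) x y = eval F x y * eval G x y := by
  have hx0 : x ≠ 0 := norm_pos_iff.1 (by linarith)
  have hy0 : y ≠ 0 := norm_pos_iff.1 (by linarith)
  set φ := LaurentPolynomial.eval₂ constK (Units.mk0 (x / y) (div_ne_zero hx0 hy0))
  have hFG := (hasSum_eval F hx hxy hx0 hy0).mul_of_nonarchimedean (hasSum_eval G hx hxy hx0 hy0)
  let e : ℤ × ℤ ≃ ℤ × ℤ :=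
    { toFun := fun p => (p.1 - p.2, p.2)
      invFun := fun p => (p.1 + p.2, p.2)
      left_inv := fun p => by ext <;> simp
      right_inv := fun p => by ext <;> simp }
  have h := e.hasSum_iff.2 hFG
  refine (hasSum_eval (F * G) hx hxy hx0 hy0).unique (h.prod_fiberwise fun m => ?_)
  -- The Cauchy product collects the finitely many nonzero products of total degree `-m`.
  rw [HahnSeries.coeff_mul, map_sum, Finset.sum_mul]
  have hsum : ∑ ij ∈ Finset.antidiagonal F.isPWO_support G.isPWO_support m,
        φ (F.coeff ij.1 * G.coeff ij.2) * y ^ (-m) =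
      ∑ n ∈ (Finset.antidiagonal F.isPWO_support G.isPWO_support m).image Prod.snd,
        φ (F.coeff (m - n)) * y ^ (-(m - n)) * (φ (G.coeff n) * y ^ (-n)) := by
    rw [Finset.sum_image]
    · refine Finset.sum_congr rfl fun ij hij => ?_
      have hm : ij.1 + ij.2 = m := (Finset.mem_antidiagonal.1 hij).2.2
      have e1 : ij.1 = m - ij.2 := by omega
      have e2 : -m = -(m - ij.2) + -ij.2 := by ring
      rw [← e1, map_mul, e2, ← e1, zpow_add₀ hy0]
      ring
    · intro p hp q hq hpq
      have hp' := (Finset.mem_antidiagonal.1 hp).2.2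
      have hq' := (Finset.mem_antidiagonal.1 hq).2.2
      ext <;> omega
  rw [hsum]
  refine hasSum_sum_of_ne_finset_zero fun n hn => ?_
  change φ (F.coeff (m - n)) * y ^ (-(m - n)) * (φ (G.coeff n) * y ^ (-n)) = 0
  by_contra hne
  apply hn
  rw [Finset.mem_image]
  refine ⟨(m - n, n), Finset.mem_antidiagonal.2 ⟨fun h0 => hne ?_, fun h0 => hne ?_, ?_⟩, rfl⟩
  · simp [h0]
  · simp [h0]
  · simp

/-- Evaluation at a point `(x, y)` with `1 < |x| = |y|` as a ring homomorphism. -/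
noncomputable def evalHom (x y : KInf) (hx : 1 < ‖x‖) (hxy : ‖x‖ = ‖y‖) : LInf →+* KInf where
  toFun F := eval F x y
  map_one' := by rw [← mono_zero, eval_mono]; simp
  map_mul' F G := eval_mul F G hx hxy
  map_zero' := by simp [eval, mcoeff]
  map_add' F G := eval_add F G hx hxy

theorem eval_one (x y : KInf) : eval 1 x y = 1 := by
  rw [← mono_zero, eval_mono]
  simp

theorem eval_substLaurent (W : ℂ[T;T⁻¹]) (G : LInfˣ) (x y : KInf) (hx : 1 < ‖x‖)
    (hxy : ‖x‖ = ‖y‖) :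
    eval (substLaurent W G) x y =
      LaurentPolynomial.eval₂ constK (Units.map (evalHom x y hx hxy) G) W := by
  change evalHom x y hx hxy (LaurentPolynomial.eval₂ const G W) = _
  induction W using LaurentPolynomial.induction_on' with
  | add p q hp hq => rw [map_add, map_add, map_add, hp, hq]
  | C_mul_T n a =>
    rw [LaurentPolynomial.eval₂_C_mul_T, LaurentPolynomial.eval₂_C_mul_T, map_mul, ← map_zpow,
      Units.coe_map]
    congr 1
    exact eval_const a x y

/-- The value of `W (G)` at a point depends only on the value of `G` there. -/
theorem eval_substLaurent_congr (W : ℂ[T;T⁻¹]) (G : LInfˣ) {x y x' y' : KInf} (hx : 1 < ‖x‖)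
    (hxy : ‖x‖ = ‖y‖) (hx' : 1 < ‖x'‖) (hxy' : ‖x'‖ = ‖y'‖)
    (h : eval G x y = eval G x' y') :
    eval (substLaurent W G) x y = eval (substLaurent W G) x' y' := by
  rw [eval_substLaurent W G x y hx hxy, eval_substLaurent W G x' y' hx' hxy']
  congr 2
  exact Units.ext h

/-- On the torus through `(x₁, y₁)`, rescaled to the unit torus, a series `1 + u` with `deg u < 0`
is a perturbation of `1` of size `|x₁|⁻¹ < 1`. -/
theorem NegDeg.principalOn {u : LInf} (hu : u.NegDeg) {x₁ y₁ : KInf} (hx : 1 < ‖x₁‖)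
    (hxy : ‖x₁‖ = ‖y₁‖) :
    PrincipalOn ‖x₁‖⁻¹ (unitTorus KInf) fun p => eval (1 + u) (x₁ * p.1) (y₁ * p.2) := by
  have hc : 0 ≤ ‖x₁‖⁻¹ := by positivity
  have hx0 : ‖x₁‖ ≠ 0 := by linarith
  have hnorm : ∀ p ∈ unitTorus KInf, ‖x₁ * p.1‖ = ‖x₁‖ ∧ ‖y₁ * p.2‖ = ‖x₁‖ := by
    rintro p ⟨h1, h2⟩
    rw [norm_mul, norm_mul, h1, h2, mul_one, mul_one]
    exact ⟨rfl, hxy.symm⟩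
  have hone : ∀ p ∈ unitTorus KInf, eval (1 + u) (x₁ * p.1) (y₁ * p.2) =
      1 + eval u (x₁ * p.1) (y₁ * p.2) := by
    intro p hp
    obtain ⟨h1, h2⟩ := hnorm p hp
    rw [eval_add _ _ (h1 ▸ hx) (h1.trans h2.symm), eval_one]
  have hcoef : ∀ i j : ℤ, ‖constK (mcoeff u i j) * x₁ ^ i * y₁ ^ j‖ ≤ ‖x₁‖⁻¹ := by
    intro i j
    by_cases hij : 0 ≤ i + j
    · rw [hu i j hij]
      simp
    · rw [norm_mul, norm_mul, norm_zpow, norm_zpow, ← hxy, mul_assoc, ← zpow_add₀ hx0]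
      refine (mul_le_of_le_one_left (by positivity) (norm_constK_le _)).trans ?_
      rw [← zpow_neg_one]
      exact zpow_le_zpow_right₀ hx.le (by omega)
  have hterm : ∀ (p : KInf × KInf) (i j : ℤ),
      constK (mcoeff u i j) * (x₁ * p.1) ^ i * (y₁ * p.2) ^ j =
        (constK (mcoeff u i j) * x₁ ^ i * y₁ ^ j) * (p.1 ^ i * p.2 ^ j) := by
    intro p i j
    rw [mul_zpow, mul_zpow]
    ring
  constructor
  · intro p hp
    rw [hone p hp, add_sub_cancel_left]
    refine IsUltrametricDist.norm_tsum_le_of_forall_le_of_nonneg hc fun ij => ?_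
    rw [hterm, norm_mul, norm_mul (p.1 ^ _), norm_zpow, norm_zpow, hp.1, hp.2, one_zpow, one_zpow,
      mul_one, mul_one]
    exact hcoef _ _
  · intro p hp q hq
    obtain ⟨hp1, hp2⟩ := hnorm p hp
    obtain ⟨hq1, hq2⟩ := hnorm q hq
    rw [hone p hp, hone q hq, add_sub_add_left_eq_sub, eval, eval,
      ← (summable_eval u _ _ (hp1 ▸ hx) (hp1.trans hp2.symm)).tsum_sub
        (summable_eval u _ _ (hq1 ▸ hx) (hq1.trans hq2.symm))]
    refine IsUltrametricDist.norm_tsum_le_of_forall_le_of_nonneg (by positivity) fun ij => ?_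
    rw [hterm, hterm, ← mul_sub, norm_mul]
    refine mul_le_mul (hcoef _ _) ?_ (norm_nonneg _) hc
    have e : p.1 ^ ij.1 * p.2 ^ ij.2 - q.1 ^ ij.1 * q.2 ^ ij.2 =
        p.1 ^ ij.1 * (p.2 ^ ij.2 - q.2 ^ ij.2) + (p.1 ^ ij.1 - q.1 ^ ij.1) * q.2 ^ ij.2 := by
      ring
    rw [e]
    refine (IsUltrametricDist.norm_add_le_max _ _).trans (max_le ?_ ?_)
    · rw [norm_mul, norm_zpow, hp.1, one_zpow, one_mul]
      exact (norm_zpow_sub_zpow_le hp.2 hq.2 _).trans (norm_snd_le (p - q))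
    · rw [norm_mul, norm_zpow, hq.2, one_zpow, mul_one]
      exact (norm_zpow_sub_zpow_le hp.1 hq.1 _).trans (norm_fst_le (p - q))

/-- `(1 + u) ^ a = 1 + w` with `deg w < 0`. -/
theorem negDeg_binomialPow_sub_one (a : ℚ) {u : LInf} (hu : u.NegDeg) :
    NegDeg ((binomialPow a u : LInf) - 1) := by
  have hpos := hu.orderTop_pos
  intro i j hij
  have hcoeff : ((binomialPow a u : LInf) - 1).coeff (-(i + j)) = 0 := by
    rw [HahnSeries.coeff_sub, sub_eq_zero]
    change (PowerSeries.heval u (PowerSeries.binomialSeries ℂ[T;T⁻¹] a)).coeff (-(i + j)) = _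
    rcases hij.eq_or_lt with h | h
    · rw [← h, neg_zero, PowerSeries.coeff_heval_zero, PowerSeries.binomialSeries_constantCoeff,
        HahnSeries.coeff_one, if_pos rfl]
    · rw [PowerSeries.coeff_heval, HahnSeries.coeff_one, if_neg (by omega)]
      refine finsum_eq_zero_of_forall_eq_zero fun n => ?_
      rw [HahnSeries.SummableFamily.coeff_apply,
        HahnSeries.SummableFamily.powerSeriesFamily_of_orderTop_pos hpos, HahnSeries.coeff_smul,
        HahnSeries.coeff_eq_zero_of_lt_orderTop, smul_zero]
      have h0 : (0 : WithTop ℤ) ≤ (u ^ n).orderTop :=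
        (nsmul_nonneg hpos.le n).trans HahnSeries.orderTop_nsmul_le_orderTop_pow
      refine lt_of_lt_of_le ?_ h0
      exact_mod_cast (by omega : -(i + j) < 0)
  rw [mcoeff, hcoeff]
  rfl

end LInf

/-! ### Reduction to a nondegenerate system -/

/-- The monomial part of the system has exponent matrix `((a, b), (1 - k a, 1 - k b))` of
determinant `a - b`. Multiplying the second equation by the `k`-th power of the first one leaves
`s t`, and dividing the first equation by the `b`-th power of the result leaves `s ^ (a - b)`. -/
theorem monomial_system_iff {K : Type*} [Field K] {s t β δ : K} (hs : s ≠ 0) (ht : t ≠ 0)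
    (hβ : β ≠ 0) (hδ : δ ≠ 0) (a b k : ℕ) :
    (s ^ (a : ℤ) * t ^ (b : ℤ) * β = 1 ∧
        s ^ (1 - (k : ℤ) * a) * t ^ (1 - (k : ℤ) * b) * δ = 1) ↔
      s ^ ((a : ℤ) - b) = (β * ((β ^ k * δ)⁻¹) ^ b)⁻¹ ∧ s * t = (β ^ k * δ)⁻¹ := by
  have h₁ : s ^ (a : ℤ) * t ^ (b : ℤ) = s ^ ((a : ℤ) - b) * (s * t) ^ b := by
    rw [zpow_sub₀ hs, mul_pow, zpow_natCast, zpow_natCast, zpow_natCast]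
    field_simp
  have h₂ : s ^ (1 - (k : ℤ) * a) * t ^ (1 - (k : ℤ) * b) * (s ^ (a : ℤ) * t ^ (b : ℤ)) ^ k =
      s * t := by
    rw [zpow_sub₀ hs, zpow_sub₀ ht, mul_comm (k : ℤ) a, mul_comm (k : ℤ) b, zpow_mul, zpow_mul,
      zpow_one, zpow_one, zpow_natCast, zpow_natCast, zpow_natCast, zpow_natCast, mul_pow]
    field_simp
  set A := s ^ (a : ℤ) * t ^ (b : ℤ)
  set M := s ^ (1 - (k : ℤ) * a) * t ^ (1 - (k : ℤ) * b)
  set P := s ^ ((a : ℤ) - b)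
  constructor
  · rintro ⟨hA, hM⟩
    have hQ : s * t = (β ^ k * δ)⁻¹ := by
      rw [← h₂, ← mul_eq_one_iff_eq_inv₀ (mul_ne_zero (pow_ne_zero _ hβ) hδ)]
      calc M * A ^ k * (β ^ k * δ) = (A * β) ^ k * (M * δ) := by ring
        _ = 1 := by rw [hA, hM, one_pow, one_mul]
    refine ⟨?_, hQ⟩
    rw [← hQ, ← mul_eq_one_iff_eq_inv₀ (mul_ne_zero hβ (pow_ne_zero _ (mul_ne_zero hs ht))), ← hA,
      h₁]
    ring
  · rintro ⟨hP, hQ⟩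
    have hA : A * β = 1 := by
      rw [h₁, hP, ← hQ, mul_inv]
      have := pow_ne_zero b (mul_ne_zero hs ht)
      field_simp
    refine ⟨hA, ?_⟩
    have h₃ : M * δ * (A * β) ^ k = 1 := by
      calc M * δ * (A * β) ^ k = M * A ^ k * (β ^ k * δ) := by ring
        _ = 1 := by rw [h₂, hQ, inv_mul_cancel₀ (mul_ne_zero (pow_ne_zero _ hβ) hδ)]
    rwa [hA, one_pow, mul_one] at h₃

namespace LInf

/-- The fibre through `(x₁, y₁)` of the pair of series `X ^ a Y ^ b (1 + w)` and
`X ^ (1 - k a) Y ^ (1 - k b) (1 + z)`, in the coordinates `(x₁ s, y₁ t)`, consists of `|a - b|`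
points of norm one. -/
theorem encard_rescaled_fibre {a b : ℕ} (hab : a ≠ b) (k : ℕ) {w z : LInf} (hw : w.NegDeg)
    (hz : z.NegDeg) {x₁ y₁ : KInf} (hx : 1 < ‖x₁‖) (hxy : ‖x₁‖ = ‖y₁‖) :
    {p ∈ unitTorus KInf |
      eval (mono a b * (1 + w)) (x₁ * p.1) (y₁ * p.2) = eval (mono a b * (1 + w)) x₁ y₁ ∧
      eval (mono (1 - (k : ℤ) * a) (1 - (k : ℤ) * b) * (1 + z)) (x₁ * p.1) (y₁ * p.2) =
        eval (mono (1 - (k : ℤ) * a) (1 - (k : ℤ) * b) * (1 + z)) x₁ y₁}.encard =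
      (((a : ℤ) - b).natAbs : ℕ∞) := by
  have hc₀ : 0 ≤ ‖x₁‖⁻¹ := by positivity
  have hc : ‖x₁‖⁻¹ < 1 := inv_lt_one_of_one_lt₀ hx
  have hx0 : x₁ ≠ 0 := norm_pos_iff.1 (by linarith)
  have hy0 : y₁ ≠ 0 := norm_pos_iff.1 (by linarith)
  have hone : ((1, 1) : KInf × KInf) ∈ unitTorus KInf := ⟨norm_one, norm_one⟩
  -- The values of `1 + w` and `1 + z`, normalised to be `1` at `(x₁, y₁)`.
  have normalise : ∀ {v : LInf}, v.NegDeg → PrincipalOn ‖x₁‖⁻¹ (unitTorus KInf) fun p =>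
      eval (1 + v) (x₁ * p.1) (y₁ * p.2) * (eval (1 + v) x₁ y₁)⁻¹ := by
    intro v hv
    have h := hv.principalOn hx hxy
    have h1 := (h.inv hc).norm_sub_one_le _ hone
    simp only [mul_one] at h1
    exact h.mul (PrincipalOn.const hc₀ h1) hc
  have hβ := normalise hw
  have hδ := normalise hz
  set β : KInf × KInf → KInf := fun p =>
    eval (1 + w) (x₁ * p.1) (y₁ * p.2) * (eval (1 + w) x₁ y₁)⁻¹
  set δ : KInf × KInf → KInf := fun p =>
    eval (1 + z) (x₁ * p.1) (y₁ * p.2) * (eval (1 + z) x₁ y₁)⁻¹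
  have hV := ((hβ.pow hc₀ hc k).mul hδ hc).inv hc
  have hU := (hβ.mul (hV.pow hc₀ hc b) hc).inv hc
  have hN0 : ((a : ℤ) - b).natAbs ≠ 0 := by omega
  have hN : ‖((((a : ℤ) - b).natAbs : ℕ) : KInf)‖ = 1 := by
    rw [← map_natCast constK]
    exact norm_constK _ (by exact_mod_cast hN0)
  have hroot := (Complex.isPrimitiveRoot_exp _ hN0).map_of_injective constK.injective
  rw [← encard_unitTorus_of_zpow hc₀ hc hN hroot hU hV]
  congr 1
  ext p
  refine and_congr_right fun hp => ?_
  have hs : p.1 ≠ 0 := norm_ne_zero_iff.1 (by rw [hp.1]; exact one_ne_zero)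
  have ht : p.2 ≠ 0 := norm_ne_zero_iff.1 (by rw [hp.2]; exact one_ne_zero)
  rw [← monomial_system_iff hs ht (hβ.ne_zero hc hp) (hδ.ne_zero hc hp) a b k]
  have hpx : 1 < ‖x₁ * p.1‖ := by rw [norm_mul, hp.1, mul_one]; exact hx
  have hpxy : ‖x₁ * p.1‖ = ‖y₁ * p.2‖ := by rw [norm_mul, norm_mul, hp.1, hp.2, hxy]
  have key : ∀ (i j : ℤ) {v : LInf}, v.NegDeg →
      (eval (mono i j * (1 + v)) (x₁ * p.1) (y₁ * p.2) = eval (mono i j * (1 + v)) x₁ y₁ ↔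
        p.1 ^ i * p.2 ^ j * (eval (1 + v) (x₁ * p.1) (y₁ * p.2) * (eval (1 + v) x₁ y₁)⁻¹) = 1) := by
    intro i j v hv
    have h0 : eval (1 + v) x₁ y₁ ≠ 0 := by
      simpa using (hv.principalOn hx hxy).ne_zero hc hone
    have hm : x₁ ^ i * y₁ ^ j ≠ 0 := mul_ne_zero (zpow_ne_zero _ hx0) (zpow_ne_zero _ hy0)
    rw [eval_mul _ _ hpx hpxy, eval_mul _ _ hx hxy, eval_mono, eval_mono, mul_zpow, mul_zpow,
      ← mul_assoc (p.1 ^ i * p.2 ^ j), mul_inv_eq_one₀ h0, mul_mul_mul_comm, mul_assoc,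
      mul_right_inj' hm]
  exact and_congr (key a b hw) (key _ _ hz)

/-- Every fibre of `(f, g ^ (1/k))` on a torus is empty or has `|n₁ - n₂| / k` points. -/
theorem encard_fibre {n₁ n₂ k : ℕ} (hk : 0 < k) (h₁ : k ∣ n₁) (h₂ : k ∣ n₂) (hne : n₁ ≠ n₂)
    {f g u z : LInf} (hu : u.NegDeg) (hg : g = mono n₁ n₂ * (1 + u)) (W : ℂ[T;T⁻¹]) {d : ℂ}
    (hd : d ≠ 0) (hz : z.NegDeg)
    (hf : f - substLaurent W (kthRoot n₁ n₂ k g) = const d * mono (1 - n₁) (1 - n₂) * (1 + z))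
    {x₁ y₁ : KInf} (hx : 1 < ‖x₁‖) (hxy : ‖x₁‖ = ‖y₁‖) :
    {p ∈ torus ‖x₁‖ | eval f p.1 p.2 = eval f x₁ y₁ ∧
      eval (kthRoot n₁ n₂ k g) p.1 p.2 = eval (kthRoot n₁ n₂ k g) x₁ y₁}.encard =
      ((((n₁ : ℤ) - n₂).natAbs / k : ℕ) : ℕ∞) := by
  obtain ⟨a, rfl⟩ := h₁
  obtain ⟨b, rfl⟩ := h₂
  have hab : a ≠ b := fun h => hne (by rw [h])
  have hx0 : x₁ ≠ 0 := norm_pos_iff.1 (by linarith)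
  have hy0 : y₁ ≠ 0 := norm_pos_iff.1 (by linarith)
  have hcount : (((k * a : ℕ) : ℤ) - (k * b : ℕ)).natAbs / k = ((a : ℤ) - b).natAbs := by
    push_cast
    rw [← mul_sub, Int.natAbs_mul, Int.natAbs_natCast, Nat.mul_div_cancel_left _ hk]
  set w : LInf := (binomialPow (1 / (k : ℚ)) u : LInf) - 1 with hwdef
  have hw : w.NegDeg := negDeg_binomialPow_sub_one _ hu
  have hG : (kthRoot (k * a) (k * b) k g : LInf) = mono a b * (1 + w) := by
    have hu' : mono (-((k * a : ℕ) : ℤ)) (-((k * b : ℕ) : ℤ)) * g - 1 = u := by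
      rw [hg, ← mul_assoc, mono_mul, neg_add_cancel, neg_add_cancel, mono_zero]
      ring
    rw [kthRoot, hu', Units.val_mul, hwdef, add_sub_cancel, Nat.mul_div_cancel_left _ hk,
      Nat.mul_div_cancel_left _ hk]
    rfl
  set G := kthRoot (k * a) (k * b) k g
  have hdK : constK d ≠ 0 := (map_ne_zero constK).2 hd
  have hfeval : ∀ {x y : KInf}, 1 < ‖x‖ → ‖x‖ = ‖y‖ → eval f x y =
      eval (substLaurent W G) x y +
        constK d * eval (mono (1 - (k : ℤ) * a) (1 - (k : ℤ) * b) * (1 + z)) x y := by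
    intro x y hx hxy
    have hf' := sub_eq_iff_eq_add'.1 hf
    push_cast at hf'
    rw [← eval_const d x y, ← eval_mul _ _ hx hxy, ← eval_add _ _ hx hxy, ← mul_assoc, ← hf']
  have himage : {p ∈ torus ‖x₁‖ | eval f p.1 p.2 = eval f x₁ y₁ ∧
      eval G p.1 p.2 = eval G x₁ y₁} = (fun p => (x₁ * p.1, y₁ * p.2)) '' {p ∈ unitTorus KInf |
      eval (mono a b * (1 + w)) (x₁ * p.1) (y₁ * p.2) = eval (mono a b * (1 + w)) x₁ y₁ ∧
      eval (mono (1 - (k : ℤ) * a) (1 - (k : ℤ) * b) * (1 + z)) (x₁ * p.1) (y₁ * p.2) =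
        eval (mono (1 - (k : ℤ) * a) (1 - (k : ℤ) * b) * (1 + z)) x₁ y₁} := by
    have hiff : ∀ {x y : KInf}, ‖x‖ = ‖x₁‖ → ‖y‖ = ‖x₁‖ →
        ((eval f x y = eval f x₁ y₁ ∧ eval G x y = eval G x₁ y₁) ↔
          eval (mono a b * (1 + w)) x y = eval (mono a b * (1 + w)) x₁ y₁ ∧
          eval (mono (1 - (k : ℤ) * a) (1 - (k : ℤ) * b) * (1 + z)) x y =
            eval (mono (1 - (k : ℤ) * a) (1 - (k : ℤ) * b) * (1 + z)) x₁ y₁) := by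
      intro x y h1 h2
      have hx' : 1 < ‖x‖ := h1 ▸ hx
      have hxy' : ‖x‖ = ‖y‖ := h1.trans h2.symm
      rw [and_comm, ← hG]
      refine and_congr_right fun h => ?_
      rw [hfeval hx' hxy', hfeval hx hxy, eval_substLaurent_congr W G hx' hxy' hx hxy h,
        add_right_inj, mul_right_inj' hdK]
    ext ⟨x, y⟩
    constructor
    · rintro ⟨⟨h1, h2⟩, h⟩
      refine ⟨(x₁⁻¹ * x, y₁⁻¹ * y), ⟨⟨?_, ?_⟩, ?_⟩, ?_⟩
      · rw [norm_mul, norm_inv, h1, inv_mul_cancel₀ (norm_ne_zero_iff.2 hx0)]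
      · rw [norm_mul, norm_inv, h2, ← hxy, inv_mul_cancel₀ (norm_ne_zero_iff.2 hx0)]
      · simp only [mul_inv_cancel_left₀ hx0, mul_inv_cancel_left₀ hy0]
        exact (hiff h1 h2).1 h
      · simp only [mul_inv_cancel_left₀ hx0, mul_inv_cancel_left₀ hy0]
    · rintro ⟨⟨s, t⟩, ⟨⟨h1, h2⟩, h⟩, hp⟩
      obtain ⟨rfl, rfl⟩ := Prod.ext_iff.1 hp
      have h1' : ‖x₁ * s‖ = ‖x₁‖ := by rw [norm_mul, h1, mul_one]
      have h2' : ‖y₁ * t‖ = ‖x₁‖ := by rw [norm_mul, h2, mul_one, hxy]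
      exact ⟨⟨h1', h2'⟩, (hiff h1' h2').2 h⟩
  have hinj : Function.Injective fun p : KInf × KInf => (x₁ * p.1, y₁ * p.2) := by
    intro p q h
    obtain ⟨h1, h2⟩ := Prod.ext_iff.1 h
    exact Prod.ext (mul_left_cancel₀ hx0 h1) (mul_left_cancel₀ hy0 h2)
  rw [himage, hinj.encard_image, encard_rescaled_fibre hab k hw hz hx hxy, hcount]

end LInf

theorem proposition1
    (n₁ n₂ k : ℕ) (hn₁ : 0 < n₁) (hn₂ : 0 < n₂) (hne : n₁ ≠ n₂) (hk : k = Nat.gcd n₁ n₂)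
    (f g : LInf)
    (hg : ∃ u : LInf, u.NegDeg ∧ g = LInf.mono n₁ n₂ * (1 + u))
    (W : ℂ[T;T⁻¹]) (d : ℂ) (hd : d ≠ 0)
    (hf : ∃ z : LInf, z.NegDeg ∧
      f - LInf.substLaurent W (LInf.kthRoot n₁ n₂ k g) =
        LInf.const d * LInf.mono (1 - n₁) (1 - n₂) * (1 + z))
    (ε : ℂ) (hε : IsPrimitiveRoot ε k)
    (ρ₀ ρ : ℝ) (hρ₀ : 1 < ρ₀)
    (x₀ y₀ : KInf) (hV : (x₀, y₀) ∈ annulusV ρ₀ ρ)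
    (i : ℕ) (hi : i < k) :
    {p ∈ torus ‖x₀‖ |
        LInf.eval f p.1 p.2 = LInf.eval f x₀ y₀ ∧
        constK (ε ^ i) * LInf.eval (LInf.kthRoot n₁ n₂ k g) p.1 p.2 =
          LInf.eval (LInf.kthRoot n₁ n₂ k g) x₀ y₀}.encard =
        ((((n₁ : ℤ) - (n₂ : ℤ)).natAbs / k : ℕ) : ℕ∞) ↔
      ∃ p ∈ torus ‖x₀‖,
        LInf.eval f p.1 p.2 = LInf.eval f x₀ y₀ ∧
        constK (ε ^ i) * LInf.eval (LInf.kthRoot n₁ n₂ k g) p.1 p.2 =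
          LInf.eval (LInf.kthRoot n₁ n₂ k g) x₀ y₀ := by
  have hk0 : 0 < k := hk ▸ Nat.gcd_pos_of_pos_left _ hn₁
  have h₁ : k ∣ n₁ := hk ▸ Nat.gcd_dvd_left _ _
  have h₂ : k ∣ n₂ := hk ▸ Nat.gcd_dvd_right _ _
  obtain ⟨u, hu, hg⟩ := hg
  obtain ⟨z, hz, hf⟩ := hf
  have hdvd : k ∣ ((n₁ : ℤ) - n₂).natAbs :=
    Int.natCast_dvd.1 (dvd_sub (Int.natCast_dvd_natCast.2 h₁) (Int.natCast_dvd_natCast.2 h₂))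
  have hpos : 0 < ((n₁ : ℤ) - n₂).natAbs / k :=
    Nat.div_pos (Nat.le_of_dvd (by omega) hdvd) hk0
  constructor
  · intro h
    exact Set.encard_ne_zero.1 (h.trans_ne (by exact_mod_cast hpos.ne'))
  · rintro ⟨⟨x₁, y₁⟩, ⟨hx₁, hy₁⟩, hf₁, hG₁⟩
    simp only at hx₁ hy₁ hf₁ hG₁
    have hx : 1 < ‖x₁‖ := by rw [hx₁]; exact hρ₀.trans_le hV.1
    have hε0 : constK (ε ^ i) ≠ 0 :=
      (map_ne_zero constK).2 (pow_ne_zero _ (hε.ne_zero hk0.ne'))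
    rw [← LInf.encard_fibre hk0 h₁ h₂ hne hu hg W hd hz hf hx (hx₁.trans hy₁.symm), ← hx₁,
      ← hf₁, ← hG₁]
    simp only [mul_right_inj' hε0]
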